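/- **Lemma I (degrees and Laplacian eigenvalues of sampled graphs).** Let $W:[0,1]^2\to[0,1]$ be a graphon, i.e. a symmetric measurable function (no lower bound on $W$ is assumed), let $N\ge 1$ be an integer and $\nu\in(0,1)$. Let $X_1\le\dots\le X_N$ be the order statistics of $N$ independent uniform random variables on $[0,1]$. Given $X=(X_1,\dots,X_N)$, let $\bar G_N$ be the weighted graph with adjacency matrix $\bar A_N=(W(X_i,X_j))_{1\le i,j\le N}$, and let $G_N$ be the random graph on $\{1,\dots,N\}$ with symmetric $0/1$ adjacency matrix $A_N$ whose entries $(A_N)_{ij}$, $i\le j$, are, conditionally on $X$, independent Bernoulli variables with means $W(X_i,X_j)$. Let $d_i=\sum_{j=1}^N (A_N)_{ij}$ and $\bar d_i=\sum_{j=1}^N(\bar A_N)_{ij}$ be the degrees, $\delta_i=d_i/N$ and $\bar\delta_i=\bar d_i/N$ the normalized degrees, and let the index $(i)$ denote the $i$-th smallest value, so that $\bar d_{(N)}=\max_i\bar d_i$. Let $L_N=\mathrm{diag}(d_1,\dots,d_N)-A_N$ and $\bar L_N=\mathrm{diag}(\bar d_1,\dots,\bar d_N)-\bar A_N$, and let $\mu_1\le\dots\le\mu_N$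 and $\bar\mu_1\le\dots\le\bar\mu_N$ be the eigenvalues, with multiplicity, of $L_N/N$ and $\bar L_N/N$. Then: 1. With probability at least $1-\nu$, $$\max_{i=1,\dots,N}|\delta_{(i)}-\bar\delta_{(i)}|\le\gamma(N):=\sqrt{\frac{\log(2N/\nu)}{N}} .$$ 2. If the event $E=\{\bar d_{(N)}>\tfrac49\log(2N/\nu)\}$ has positive probability, then, conditionally on $E$, with probability at least $1-2\nu$, $$\max_{i=1,\dots,N}|\mu_i-\bar\mu_i|\le\varphi(N):=3\sqrt{\frac{\log(2N/\nu)}{N}} .$$ Moreover, both bounds hold conditionally on the latent variables: for every fixed $x\in[0,1]^N$, when $G_N$ and $\bar G_N$ are built as above with $X=x$, the first bound holds with probability at least $1-\nu$, and, if $\bar d_{(N)}>\frac49\log(2N/\nu)$ for this $x$, the second bound holds with probability at least $1-2\nu$. -/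

import Mathlib

noncomputable section

namespace GraphonSampling

open MeasureTheory ProbabilityTheory unitInterval

/-- A graphon: a symmetric measurable function `W : [0,1]² → [0,1]`. -/
structure Graphon where
  /-- the values `W(x, y)` -/
  val : I → I → I
  symm : ∀ x y, val x y = val y x
  measurable : Measurable (Function.uncurry val)

/-! ### Sorting a finite family -/

/-- The family `f` rearranged in nondecreasing order: `orderStat f i` is the `i`-th smallest value
of `f`, counted with multiplicity. -/
def orderStat {α : Type*} [LinearOrder α] {N : ℕ} (f : Fin N → α) : Fin N → α :=
  f ∘ Tuple.sort f

theorem measurable_orderStat (N : ℕ) :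
    Measurable (orderStat : (Fin N → I) → (Fin N → I)) := by
  have key : ∀ τ : Equiv.Perm (Fin N), MeasurableSet {f : Fin N → I | Monotone (f ∘ τ)} := by
    intro τ
    have : {f : Fin N → I | Monotone (f ∘ τ)}
        = ⋂ i : Fin N, ⋂ j : Fin N, ⋂ _ : i ≤ j, {f : Fin N → I | f (τ i) ≤ f (τ j)} := by
      ext f
      simp [Monotone]
    rw [this]
    refine MeasurableSet.iInter fun i => MeasurableSet.iInter fun j => MeasurableSet.iInter fun _ =>
      measurableSet_le (measurable_pi_apply _) (measurable_pi_apply _)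
  intro s hs
  have : orderStat ⁻¹' s = ⋃ τ : Equiv.Perm (Fin N),
      {f : Fin N → I | Monotone (f ∘ τ)} ∩ {f : Fin N → I | (f ∘ τ) ∈ s} := by
    ext f
    simp only [Set.mem_preimage, Set.mem_iUnion, Set.mem_inter_iff, Set.mem_ofPred_eq]
    constructor
    · intro h
      exact ⟨Tuple.sort f, Tuple.monotone_sort f, h⟩
    · rintro ⟨τ, h1, h2⟩
      have h3 : f ∘ τ = f ∘ Tuple.sort f := Tuple.comp_sort_eq_comp_iff_monotone.mpr h1
      unfold orderStat
      rw [← h3]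
      exact h2
  rw [this]
  refine MeasurableSet.iUnion fun τ => (key τ).inter ?_
  have hm : Measurable fun f : Fin N → I => f ∘ τ :=
    measurable_pi_lambda _ fun i => measurable_pi_apply (τ i)
  exact hm hs

/-! ### Sampling from a graphon -/

/-- The law of the latent variables `X₁ ≤ ⋯ ≤ X_N`: the order statistics of `N` independent
uniform random variables on `[0,1]`. -/
def latentLaw (N : ℕ) : Measure (Fin N → I) :=
  (volume : Measure (Fin N → I)).map orderStat

instance (N : ℕ) : IsProbabilityMeasure (latentLaw N) :=
  Measure.isProbabilityMeasure_map (measurable_orderStat N).aemeasurable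

/-- The probability `W(xᵢ, xⱼ)` of the edge joining the unordered pair `{i, j}`. -/
def edgeProb (W : Graphon) {N : ℕ} (x : Fin N → I) : Sym2 (Fin N) → I :=
  Sym2.lift ⟨fun i j => W.val (x i) (x j), fun i j => W.symm (x i) (x j)⟩

/-- A graph on `{1, …, N}`, recorded as the set of its edges (the unordered pairs with value
`true`); the pair `{i, i}` stands for a loop at `i`. -/
abbrev EdgeSet (N : ℕ) : Type := Sym2 (Fin N) → Bool

/-- The conditional law of the sampled graph `G_N` given the latent variables `x`: every unordered
pair `{i, j}` is an edge with probability `W(xᵢ, xⱼ)`, independently of the other pairs. -/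
def edgeLaw (W : Graphon) {N : ℕ} (x : Fin N → I) : Measure (EdgeSet N) :=
  Measure.pi fun e => bernoulliMeasure true false (edgeProb W x e)

instance (W : Graphon) {N : ℕ} (x : Fin N → I) : IsProbabilityMeasure (edgeLaw W x) := by
  unfold edgeLaw
  infer_instance

theorem measurable_edgeProb (W : Graphon) (N : ℕ) (e : Sym2 (Fin N)) :
    Measurable fun x : Fin N → I => edgeProb W x e := by
  induction e using Sym2.ind with
  | _ i j =>
    have h : Measurable fun x : Fin N → I => (x i, x j) :=
      (measurable_pi_apply i).prodMk (measurable_pi_apply j)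
    exact W.measurable.comp h

theorem measurable_edgeLaw (W : Graphon) (N : ℕ) :
    Measurable fun x : Fin N → I => edgeLaw W x := by
  classical
  refine Measure.measurable_of_measurable_coe _ fun s _ => ?_
  have h : ∀ x : Fin N → I, edgeLaw W x s
      = ∑ f ∈ s.toFinset, ∏ e, bernoulliMeasure true false (edgeProb W x e) {f e} := by
    intro x
    have h1 : edgeLaw W x s = ∑ f ∈ s.toFinset, edgeLaw W x {f} := by
      rw [sum_measure_singleton, Set.coe_toFinset]
    rw [h1]
    exact Finset.sum_congr rfl fun f _ => by rw [edgeLaw, Measure.pi_singleton]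
  simp_rw [h]
  refine Finset.measurable_sum _ fun f _ => Finset.measurable_prod _ fun e _ => ?_
  have hp := measurable_edgeProb W N e
  have hN : Continuous (toNNReal : I → NNReal) := unitInterval.toNNReal_continuous
  have h1 : Measurable fun x : Fin N → I => (toNNReal (edgeProb W x e) : ENNReal) :=
    (hN.measurable.comp hp).coe_nnreal_ennreal
  have h2 : Measurable fun x : Fin N → I => (toNNReal (σ (edgeProb W x e)) : ENNReal) :=
    ((hN.comp unitInterval.continuous_symm).measurable.comp hp).coe_nnreal_ennreal
  simp_rw [bernoulliMeasure_apply _ (MeasurableSet.singleton (f e))]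
  cases f e <;> simp [h1, h2]

/-- The conditional law of the sampled graph given the latent variables, as a kernel. -/
def edgeKernel (W : Graphon) (N : ℕ) : Kernel (Fin N → I) (EdgeSet N) where
  toFun x := edgeLaw W x
  measurable' := measurable_edgeLaw W N

instance (W : Graphon) (N : ℕ) : IsMarkovKernel (edgeKernel W N) :=
  ⟨fun x => inferInstanceAs (IsProbabilityMeasure (edgeLaw W x))⟩

/-- The joint law of the latent variables `X₁ ≤ ⋯ ≤ X_N` and of the graph `G_N` sampled
from `W`. -/
def sampleLaw (W : Graphon) (N : ℕ) : Measure ((Fin N → I) × EdgeSet N) :=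
  latentLaw N ⊗ₘ edgeKernel W N

/-! ### Adjacency matrices, degrees and Laplacian eigenvalues -/

/-- The adjacency matrix `A_N` of the sampled graph `G_N`. -/
def adj {N : ℕ} (e : EdgeSet N) : Matrix (Fin N) (Fin N) ℝ :=
  Matrix.of fun i j => if e s(i, j) then 1 else 0

/-- The adjacency matrix of the weighted graph with weights `W(xᵢ, xⱼ)`. -/
def weightedAdj (W : Graphon) {N : ℕ} (x : Fin N → I) : Matrix (Fin N) (Fin N) ℝ :=
  Matrix.of fun i j => (W.val (x i) (x j) : ℝ)

theorem adj_isSymm {N : ℕ} (e : EdgeSet N) : (adj e).IsSymm := by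
  ext i j
  simp [adj, Sym2.eq_swap]

theorem weightedAdj_isSymm (W : Graphon) {N : ℕ} (x : Fin N → I) :
    (weightedAdj W x).IsSymm := by
  ext i j
  simp [weightedAdj, W.symm (x j) (x i)]

/-- The degrees: the row sums of the adjacency matrix. -/
def deg {N : ℕ} (A : Matrix (Fin N) (Fin N) ℝ) (i : Fin N) : ℝ := ∑ j, A i j

/-- The sorted normalized degrees `δ₍₁₎ ≤ ⋯ ≤ δ₍N₎`, where `δᵢ = dᵢ / N`. -/
def sortedNormDeg {N : ℕ} (A : Matrix (Fin N) (Fin N) ℝ) : Fin N → ℝ :=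
  orderStat fun i => deg A i / N

/-- The Laplacian matrix `L = D - A`, with `D` the diagonal matrix of the degrees. -/
def laplacian {N : ℕ} (A : Matrix (Fin N) (Fin N) ℝ) : Matrix (Fin N) (Fin N) ℝ :=
  Matrix.diagonal (deg A) - A

theorem laplacian_isHermitian {N : ℕ} {A : Matrix (Fin N) (Fin N) ℝ} (hA : A.IsSymm) :
    (laplacian A).IsHermitian := by
  rw [Matrix.IsHermitian, Matrix.conjTranspose_eq_transpose_of_trivial, laplacian,
    Matrix.transpose_sub, Matrix.diagonal_transpose, hA.eq]

/-- The normalized Laplacian eigenvalues `μ₁ ≤ ⋯ ≤ μ_N`: the eigenvalues of `L = D - A`, with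
multiplicity and in nondecreasing order, divided by `N`. -/
def normLapEig {N : ℕ} {A : Matrix (Fin N) (Fin N) ℝ} (hA : A.IsSymm) (i : Fin N) : ℝ :=
  orderStat (laplacian_isHermitian hA).eigenvalues i / N

/-! ### The events -/

/-- `max_i |δ₍ᵢ₎ - δ̄₍ᵢ₎| ≤ r`. -/
def DegreesClose (W : Graphon) {N : ℕ} (r : ℝ) (x : Fin N → I) (e : EdgeSet N) : Prop :=
  ∀ i, |sortedNormDeg (adj e) i - sortedNormDeg (weightedAdj W x) i| ≤ r

/-- `max_i |μᵢ - μ̄ᵢ| ≤ r`. -/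
def EigenvaluesClose (W : Graphon) {N : ℕ} (r : ℝ) (x : Fin N → I) (e : EdgeSet N) : Prop :=
  ∀ i, |normLapEig (adj_isSymm e) i - normLapEig (weightedAdj_isSymm W x) i| ≤ r

/-- The largest degree `d̄₍N₎` of the weighted graph. -/
def maxWeightedDeg (W : Graphon) {N : ℕ} (hN : 0 < N) (x : Fin N → I) : ℝ :=
  orderStat (deg (weightedAdj W x)) ⟨N - 1, Nat.sub_lt hN Nat.one_pos⟩

end GraphonSampling

end

/-!
Fix the latent variables `x`, write `l = log (2N/ν)`, `A` for the adjacency matrix of the sampled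
graph and `Ā` for the matrix of edge probabilities. The entries of `A - Ā` on unordered pairs are
independent, centred, and take values in an interval of length `1`. By Hoeffding's inequality every
linear statistic `∑ᵢⱼ Bᵢⱼ (A - Ā)ᵢⱼ` exceeds `t` in absolute value with probability at most
`2 exp (-t² / ∑ᵢⱼ Bᵢⱼ²)` (`measureReal_le_abs_sum_le`; merging `(i, j)` with `(j, i)` costs the
factor `2` in `sum_sq_fiber_le`).

*Degrees.* With `B` the indicator of a row and `t = √(N l)`, a union bound over the `N` rows shows
that all degrees are within `√(N l)` of their means outside an event of probability at most `ν`.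
Sorting is `1`-Lipschitz for the sup norm (`abs_orderStat_sub_le`), so the same bound holds for the
sorted degrees.

*Eigenvalues.* By Weyl's inequality (`abs_orderStat_eigenvalues_sub_le`) it suffices to bound the
quadratic form of `L - L̄ = (D - D̄) - (A - Ā)`. The diagonal part is controlled by the degrees. For
`A - Ā`, a volume argument gives a `1/2`-net of the unit sphere with at most `5 ^ N` points
(`exists_half_net_sphere`), and the quadratic form of a symmetric matrix is at most `32/17` times
its maximum over such a net (`abs_quadForm_le_of_net`). With `B = c cᵀ` for `c` in the net and
`t = (17/16) √(N l)`, this bounds the quadratic form of `A - Ā` by `2 √(N l) ‖u‖²` outside an event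
of probability at most `ν`, provided `l < 4N/9` (`five_pow_mul_exp_le`). If `l ≥ 4N/9`, the radius
`3 √(l/N)` is at least `2`, and the bound `|(A - Ā)ᵢⱼ| ≤ 1` already gives the conclusion for every
graph. Thus the conditional eigenvalue estimate holds at every `x`.

The statements under the joint law follow by integrating the conditional ones over the latent
variables (`ofReal_mul_latentLaw_le_sampleLaw`).
-/

noncomputable section

namespace GraphonSampling

open MeasureTheory ProbabilityTheory unitInterval

/-! ### Sorted families -/

/-- Sorting is monotone and commutes with adding a constant. By pigeonhole, among the `N - i` indices
where `f` is at least its `i`-th smallest value there is one of the `i + 1` indices (`i` counted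
from `0`) where `g` is at most its `i`-th smallest value. -/
theorem orderStat_le_add {N : ℕ} {f g : Fin N → ℝ} {r : ℝ} (h : ∀ i, f i ≤ g i + r) (i : Fin N) :
    orderStat f i ≤ orderStat g i + r := by
  have hf : Monotone (orderStat f) := Tuple.monotone_sort f
  have hg : Monotone (orderStat g) := Tuple.monotone_sort g
  obtain ⟨k, hk, m, hm, hkm⟩ : ∃ k, i ≤ k ∧ ∃ m, m ≤ i ∧ Tuple.sort f k = Tuple.sort g m := by
    by_contra! hne
    have hdisj : Disjoint ((Finset.Ici i).image (Tuple.sort f))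
        ((Finset.Iic i).image (Tuple.sort g)) := by
      rw [Finset.disjoint_left]
      intro a ha hb
      obtain ⟨k, hk, rfl⟩ := Finset.mem_image.mp ha
      obtain ⟨m, hm, hmk⟩ := Finset.mem_image.mp hb
      exact hne k (Finset.mem_Ici.mp hk) m (Finset.mem_Iic.mp hm) hmk.symm
    have hcard := Finset.card_le_univ
      ((Finset.Ici i).image (Tuple.sort f) ∪ (Finset.Iic i).image (Tuple.sort g))
    rw [Finset.card_union_of_disjoint hdisj,
      Finset.card_image_of_injective _ (Tuple.sort f).injective,
      Finset.card_image_of_injective _ (Tuple.sort g).injective, Fin.card_Ici, Fin.card_Iic,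
      Fintype.card_fin] at hcard
    omega
  calc orderStat f i ≤ orderStat f k := hf hk
    _ = f (Tuple.sort g m) := by rw [← hkm]; rfl
    _ ≤ orderStat g m + r := h _
    _ ≤ orderStat g i + r := by gcongr; exact hg hm

theorem abs_orderStat_sub_le {N : ℕ} {f g : Fin N → ℝ} {r : ℝ} (h : ∀ i, |f i - g i| ≤ r)
    (i : Fin N) : |orderStat f i - orderStat g i| ≤ r := by
  have h1 := orderStat_le_add (f := f) (g := g) (r := r)
    (fun i => by linarith [(abs_le.mp (h i)).2]) i
  have h2 := orderStat_le_add (f := g) (g := f) (r := r)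
    (fun i => by linarith [(abs_le.mp (h i)).1]) i
  exact abs_le.mpr ⟨by linarith, by linarith⟩

/-! ### Quadratic forms and Weyl's inequality -/

/-- The quadratic form `u ↦ uᵀ M u` of a matrix. -/
def quadForm {N : ℕ} (M : Matrix (Fin N) (Fin N) ℝ) (u : EuclideanSpace ℝ (Fin N)) : ℝ :=
  inner ℝ u (Matrix.toEuclideanLin M u)

theorem quadForm_eq_sum {N : ℕ} (M : Matrix (Fin N) (Fin N) ℝ) (u : EuclideanSpace ℝ (Fin N)) :
    quadForm M u = ∑ i, ∑ j, u i * u j * M i j := by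
  simp only [quadForm, PiLp.inner_apply, RCLike.inner_apply, conj_trivial, Matrix.ofLp_toLpLin,
    Matrix.toLin'_apply, Matrix.mulVec, dotProduct, Finset.sum_mul]
  exact Finset.sum_congr rfl fun i _ => Finset.sum_congr rfl fun j _ => by ring

theorem quadForm_sub {N : ℕ} (A B : Matrix (Fin N) (Fin N) ℝ) (u : EuclideanSpace ℝ (Fin N)) :
    quadForm (A - B) u = quadForm A u - quadForm B u := by
  simp [quadForm, inner_sub_right]

theorem quadForm_diagonal {N : ℕ} (d : Fin N → ℝ) (u : EuclideanSpace ℝ (Fin N)) :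
    quadForm (Matrix.diagonal d) u = ∑ i, d i * u i ^ 2 := by
  rw [quadForm_eq_sum]
  refine Finset.sum_congr rfl fun i _ => ?_
  rw [Finset.sum_eq_single i (fun j _ hj => by simp [Matrix.diagonal_apply_ne' _ hj]) (by simp)]
  rw [Matrix.diagonal_apply_eq]
  ring

theorem quadForm_eq_sum_eigenvalues {N : ℕ} {M : Matrix (Fin N) (Fin N) ℝ} (hM : M.IsHermitian)
    (u : EuclideanSpace ℝ (Fin N)) :
    quadForm M u = ∑ k, hM.eigenvalues k * inner ℝ (hM.eigenvectorBasis k) u ^ 2 := by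
  have hsymm := Matrix.isSymmetric_toEuclideanLin_iff.mpr hM
  have hev (k : Fin N) : Matrix.toEuclideanLin M (hM.eigenvectorBasis k)
      = hM.eigenvalues k • hM.eigenvectorBasis k := by
    have := hM.mulVec_eigenvectorBasis k
    ext j
    simpa using! congrFun this j
  rw [quadForm, ← hM.eigenvectorBasis.sum_inner_mul_inner]
  refine Finset.sum_congr rfl fun k _ => ?_
  rw [← hsymm, hev, real_inner_smul_left, real_inner_comm u]
  ring

theorem norm_sq_eq_sum_inner_sq {N : ℕ}
    (b : OrthonormalBasis (Fin N) ℝ (EuclideanSpace ℝ (Fin N))) (u : EuclideanSpace ℝ (Fin N)) :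
    ‖u‖ ^ 2 = ∑ k, inner ℝ (b k) u ^ 2 := by
  rw [← real_inner_self_eq_norm_sq, ← b.sum_inner_mul_inner]
  refine Finset.sum_congr rfl fun k _ => ?_
  rw [real_inner_comm u]
  ring

/-- The one-sided form of Weyl's inequality: some nonzero vector is orthogonal both to the
eigenvectors of `A` below the `i`-th and to those of `B` above the `i`-th; compare the two quadratic
forms there. -/
theorem orderStat_eigenvalues_le_add {N : ℕ} {A B : Matrix (Fin N) (Fin N) ℝ}
    (hA : A.IsHermitian) (hB : B.IsHermitian) {r : ℝ}
    (h : ∀ u, quadForm A u ≤ quadForm B u + r * ‖u‖ ^ 2) (i : Fin N) :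
    orderStat hA.eigenvalues i ≤ orderStat hB.eigenvalues i + r := by
  set ρ := Tuple.sort hA.eigenvalues
  set τ := Tuple.sort hB.eigenvalues
  have hmA : Monotone (orderStat hA.eigenvalues) := Tuple.monotone_sort _
  have hmB : Monotone (orderStat hB.eigenvalues) := Tuple.monotone_sort _
  -- The `N - 1` linear conditions `u ⟂ vₖ(A)` for `k < i` and `u ⟂ vₖ(B)` for `k > i`.
  let T : EuclideanSpace ℝ (Fin N) →ₗ[ℝ] ({k : Fin N // k ≠ i} → ℝ) :=
    LinearMap.pi fun k => if k.1 < i then (innerₗ _ (hA.eigenvectorBasis (ρ k)))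
      else (innerₗ _ (hB.eigenvectorBasis (τ k)))
  have hker : LinearMap.ker T ≠ ⊥ := by
    apply LinearMap.ker_ne_bot_of_finrank_lt
    have := i.pos
    simp
    omega
  obtain ⟨u, hu, hu0⟩ := Submodule.exists_mem_ne_zero_of_ne_bot hker
  have hTu (k : {k : Fin N // k ≠ i}) : T u k = 0 := by rw [LinearMap.mem_ker.mp hu]; rfl
  have h1 (k : Fin N) (hk : k < i) : inner ℝ (hA.eigenvectorBasis (ρ k)) u = 0 := by
    simpa [T, hk] using hTu ⟨k, hk.ne⟩
  have h2 (k : Fin N) (hk : i < k) : inner ℝ (hB.eigenvectorBasis (τ k)) u = 0 := by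
    simpa [T, hk.not_gt] using hTu ⟨k, hk.ne'⟩
  have hlow : orderStat hA.eigenvalues i * ‖u‖ ^ 2 ≤ quadForm A u := by
    rw [quadForm_eq_sum_eigenvalues hA, norm_sq_eq_sum_inner_sq hA.eigenvectorBasis,
      ← Equiv.sum_comp ρ, ← Equiv.sum_comp ρ (fun k => hA.eigenvalues k * _), Finset.mul_sum]
    refine Finset.sum_le_sum fun k _ => ?_
    rcases lt_or_ge k i with hk | hk
    · simp [h1 k hk]
    · exact mul_le_mul_of_nonneg_right (hmA hk) (sq_nonneg _)
  have hupp : quadForm B u ≤ orderStat hB.eigenvalues i * ‖u‖ ^ 2 := by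
    rw [quadForm_eq_sum_eigenvalues hB, norm_sq_eq_sum_inner_sq hB.eigenvectorBasis,
      ← Equiv.sum_comp τ, ← Equiv.sum_comp τ (fun k => inner ℝ _ u ^ 2), Finset.mul_sum]
    refine Finset.sum_le_sum fun k _ => ?_
    rcases lt_or_ge i k with hk | hk
    · simp [h2 k hk]
    · exact mul_le_mul_of_nonneg_right (hmB hk) (sq_nonneg _)
  have hpos : 0 < ‖u‖ ^ 2 := by positivity
  have := h u
  exact le_of_mul_le_mul_right (by linarith) hpos

/-- **Weyl's inequality**, with the operator norm of `A - B` expressed through its quadratic form. -/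
theorem abs_orderStat_eigenvalues_sub_le {N : ℕ} {A B : Matrix (Fin N) (Fin N) ℝ}
    (hA : A.IsHermitian) (hB : B.IsHermitian) {r : ℝ}
    (h : ∀ u, |quadForm (A - B) u| ≤ r * ‖u‖ ^ 2) (i : Fin N) :
    |orderStat hA.eigenvalues i - orderStat hB.eigenvalues i| ≤ r := by
  simp only [quadForm_sub, abs_le] at h
  have h1 := orderStat_eigenvalues_le_add hA hB (fun u => by linarith [(h u).2]) i
  have h2 := orderStat_eigenvalues_le_add hB hA (fun u => by linarith [(h u).1]) i
  exact abs_le.mpr ⟨by linarith, by linarith⟩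

/-! ### Nets on the unit sphere -/

/-- A maximal `1/2`-separated subset of the unit sphere is a `1/2`-net; its cardinality is bounded by
comparing volumes of balls. -/
theorem exists_half_net_sphere (N : ℕ) : ∃ S : Finset (EuclideanSpace ℝ (Fin N)),
    S.card ≤ 5 ^ N ∧ (∀ c ∈ S, ‖c‖ = 1) ∧ ∀ v, ‖v‖ = 1 → ∃ c ∈ S, ‖v - c‖ ≤ 1 / 2 := by
  classical
  let P : Finset (EuclideanSpace ℝ (Fin N)) → Prop := fun S =>
    (∀ c ∈ S, ‖c‖ = 1) ∧ ∀ c ∈ S, ∀ d ∈ S, c ≠ d → 1 / 2 ≤ ‖c - d‖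
  have hcard (S : Finset (EuclideanSpace ℝ (Fin N))) (hS : P S) : S.card ≤ 5 ^ N := by
    have h2 : Function.Injective fun c : EuclideanSpace ℝ (Fin N) => (2 : ℝ) • c :=
      smul_right_injective _ two_ne_zero
    have := Besicovitch.card_le_of_separated (S.image fun c => (2 : ℝ) • c) ?_ ?_
    · simpa [Finset.card_image_of_injective _ h2] using this
    · intro c hc
      obtain ⟨d, hd, rfl⟩ := Finset.mem_image.mp hc
      simp [norm_smul, hS.1 d hd]
    · intro c hc d hd hcd
      obtain ⟨c', hc', rfl⟩ := Finset.mem_image.mp hc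
      obtain ⟨d', hd', rfl⟩ := Finset.mem_image.mp hd
      have := hS.2 c' hc' d' hd' (fun h => hcd (by rw [h]))
      rw [← smul_sub, norm_smul, Real.norm_ofNat]
      linarith
  -- If no separated set were a net, separated sets could be enlarged indefinitely.
  by_contra! hne
  have hext : ∀ n : ℕ, ∃ S, P S ∧ S.card = n := by
    intro n
    induction n with
    | zero => exact ⟨∅, by simp [P], rfl⟩
    | succ n ih =>
      obtain ⟨S, hS, hn⟩ := ih
      obtain ⟨v, hv, hvS⟩ := hne S (hcard S hS) hS.1
      have hvnot : v ∉ S := fun h => by have := hvS v h; simp at this; linarith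
      refine ⟨insert v S, ⟨?_, ?_⟩, by rw [Finset.card_insert_of_notMem hvnot, hn]⟩
      · simpa [hv] using hS.1
      · intro c hc d hd hcd
        rcases Finset.mem_insert.mp hc with rfl | hcS <;>
          rcases Finset.mem_insert.mp hd with rfl | hdS
        · exact absurd rfl hcd
        · exact (hvS d hdS).le
        · rw [norm_sub_rev]; exact (hvS c hcS).le
        · exact hS.2 c hcS d hdS hcd
  obtain ⟨S, hS, hn⟩ := hext (5 ^ N + 1)
  have := hcard S hS
  omega

/-- The quadratic form of a symmetric matrix is controlled by its values on a `1/2`-net of the unit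
sphere. A net point `c` within `1/2` of a unit eigenvector for an eigenvalue `L` of largest modulus
has a component `a ≥ 7/8` along it, so `|cᵀ M c| ≥ |L| (2 a² - 1) ≥ (17/32) |L|`. -/
theorem abs_quadForm_le_of_net {N : ℕ} {M : Matrix (Fin N) (Fin N) ℝ} (hM : M.IsHermitian)
    {S : Finset (EuclideanSpace ℝ (Fin N))} (hS1 : ∀ c ∈ S, ‖c‖ = 1)
    (hS : ∀ v, ‖v‖ = 1 → ∃ c ∈ S, ‖v - c‖ ≤ 1 / 2) {t : ℝ} (ht : ∀ c ∈ S, |quadForm M c| ≤ t)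
    (u : EuclideanSpace ℝ (Fin N)) : |quadForm M u| ≤ 32 / 17 * t * ‖u‖ ^ 2 := by
  rcases isEmpty_or_nonempty (Fin N) with hN | hN
  · simp [Subsingleton.elim u 0, quadForm]
  obtain ⟨k₀, hk₀⟩ := Finite.exists_max fun k => |hM.eigenvalues k|
  set b := hM.eigenvectorBasis with hb
  set L := hM.eigenvalues k₀ with hL
  have hu : |quadForm M u| ≤ |L| * ‖u‖ ^ 2 := by
    rw [quadForm_eq_sum_eigenvalues hM, norm_sq_eq_sum_inner_sq b, Finset.mul_sum]
    refine (Finset.abs_sum_le_sum_abs _ _).trans (Finset.sum_le_sum fun k _ => ?_)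
    rw [abs_mul, abs_sq]
    exact mul_le_mul_of_nonneg_right (hk₀ k) (sq_nonneg _)
  obtain ⟨c, hcS, hc⟩ := hS (b k₀) (b.norm_eq_one k₀)
  have hc1 := hS1 c hcS
  set a := inner ℝ (b k₀) c with ha
  have ha78 : 7 / 8 ≤ a := by
    have h1 := norm_sub_sq_real (b k₀) c
    rw [b.norm_eq_one, hc1, ← ha] at h1
    nlinarith [norm_nonneg (b k₀ - c)]
  -- `quadForm M c` is `L a²` plus a remainder of modulus at most `|L| (1 - a²)`.
  have hrest : |quadForm M c - L * a ^ 2| ≤ |L| * (1 - a ^ 2) := by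
    have h1 : (1 : ℝ) - a ^ 2 = ∑ k ∈ Finset.univ.erase k₀, inner ℝ (b k) c ^ 2 := by
      have := norm_sq_eq_sum_inner_sq b c
      rw [hc1, ← Finset.add_sum_erase _ _ (Finset.mem_univ k₀)] at this
      linarith
    have h2 : quadForm M c - L * a ^ 2
        = ∑ k ∈ Finset.univ.erase k₀, hM.eigenvalues k * inner ℝ (b k) c ^ 2 := by
      rw [quadForm_eq_sum_eigenvalues hM, ← Finset.add_sum_erase _ _ (Finset.mem_univ k₀)]
      ring
    rw [h1, h2, Finset.mul_sum]
    refine (Finset.abs_sum_le_sum_abs _ _).trans (Finset.sum_le_sum fun k _ => ?_)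
    rw [abs_mul, abs_sq]
    exact mul_le_mul_of_nonneg_right (hk₀ k) (sq_nonneg _)
  have hLt : |L| ≤ 32 / 17 * t := by
    have h1 : |L * a ^ 2| - |quadForm M c| ≤ |quadForm M c - L * a ^ 2| := by
      rw [abs_sub_comm]; exact abs_sub_abs_le_abs_sub _ _
    rw [abs_mul, abs_sq] at h1
    have h2 := ht c hcS
    nlinarith [abs_nonneg L, mul_nonneg (abs_nonneg L) (by nlinarith : (0 : ℝ) ≤ a ^ 2 - 49 / 64)]
  exact hu.trans (mul_le_mul_of_nonneg_right hLt (sq_nonneg _))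

/-! ### Concentration of linear statistics of the sampled graph -/

theorem measurableSet_edgeSet {N : ℕ} (s : Set (EdgeSet N)) : MeasurableSet s :=
  s.toFinite.measurableSet

/-- Hoeffding's lemma for one centred edge indicator, whose range has length `1`. -/
theorem hasSubgaussianMGF_edge (W : Graphon) {N : ℕ} (x : Fin N → I) (e : Sym2 (Fin N)) :
    HasSubgaussianMGF (fun ω : EdgeSet N => (if ω e then 1 else 0) - (edgeProb W x e : ℝ))
      (1 / 4) (edgeLaw W x) := by
  have hm : Measurable fun b : Bool => if b then (1 : ℝ) else 0 := measurable_of_finite _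
  have hint : ∫ b, (if b then (1 : ℝ) else 0) ∂(bernoulliMeasure true false (edgeProb W x e))
      = edgeProb W x e := by
    rw [integral_bernoulliMeasure]
    simp
  have h := hasSubgaussianMGF_of_mem_Icc (a := 0) (b := 1)
    (μ := bernoulliMeasure true false (edgeProb W x e)) hm.aemeasurable
    (Filter.Eventually.of_forall fun b => by cases b <;> simp)
  rw [hint] at h
  have hmap : (edgeLaw W x).map (fun ω => ω e) = bernoulliMeasure true false (edgeProb W x e) :=
    (measurePreserving_eval _ e).map_eq
  rw [← hmap] at h
  have h' := HasSubgaussianMGF.of_map (Y := fun ω : EdgeSet N => ω e)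
    (measurable_pi_apply e).aemeasurable h
  have hc : ((‖(1 : ℝ) - 0‖₊ / 2) ^ 2 : NNReal) = 1 / 4 := by
    rw [sub_zero, nnnorm_one]
    norm_num [div_pow]
  exact hc ▸ h'

theorem iIndepFun_edge (W : Graphon) {N : ℕ} (x : Fin N → I) (a : Sym2 (Fin N) → ℝ) :
    iIndepFun (fun e (ω : EdgeSet N) => a e * ((if ω e then 1 else 0) - (edgeProb W x e : ℝ)))
      (edgeLaw W x) :=
  iIndepFun_pi (X := fun e (b : Bool) => a e * ((if b then 1 else 0) - (edgeProb W x e : ℝ)))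
    fun _ => (measurable_of_finite _).aemeasurable

/-- Hoeffding's inequality for weighted sums over unordered pairs. The case where all coefficients
vanish is separate, because the sub-Gaussian tail bound then divides by zero. -/
theorem hoeffding_edge (W : Graphon) {N : ℕ} (x : Fin N → I) (a : Sym2 (Fin N) → ℝ) {t c : ℝ}
    (ht : 0 ≤ t) (hc : 0 < c) (ha : ∑ e, a e ^ 2 ≤ 2 * c) :
    (edgeLaw W x).real
        {ω : EdgeSet N | t ≤ ∑ e, a e * ((if ω e then 1 else 0) - (edgeProb W x e : ℝ))}
      ≤ Real.exp (-t ^ 2 / c) := by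
  rcases (Finset.sum_nonneg fun e _ => sq_nonneg (a e)).eq_or_lt with h0 | h0
  · have ha0 (e) : a e = 0 := by
      have := (Finset.sum_eq_zero_iff_of_nonneg (fun e _ => sq_nonneg (a e))).mp h0.symm e
        (Finset.mem_univ e)
      simpa using this
    rcases ht.eq_or_lt with rfl | ht'
    · simp [ha0]
    · simp [ha0, ht'.not_ge, Real.exp_nonneg]
  · have h := HasSubgaussianMGF.measure_sum_ge_le_of_iIndepFun (iIndepFun_edge W x a)
      (s := Finset.univ) (fun e _ => (hasSubgaussianMGF_edge W x e).const_mul (a e)) ht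
    refine h.trans (Real.exp_le_exp.mpr ?_)
    have hsum : ((∑ e, NNReal.mk (a e ^ 2) (sq_nonneg (a e)) * (1 / 4) : NNReal) : ℝ)
        = (∑ e, a e ^ 2) / 4 := by
      rw [NNReal.coe_sum, Finset.sum_div]
      refine Finset.sum_congr rfl fun e _ => ?_
      rw [NNReal.coe_mul, NNReal.coe_mk]
      push_cast
      ring
    refine (congrArg (fun r : ℝ => -t ^ 2 / (2 * r)) hsum).trans_le ?_
    rw [div_le_div_iff₀ (by linarith) hc]
    nlinarith [mul_le_mul_of_nonneg_left ha (sq_nonneg t)]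

/-- Collects a sum over ordered pairs into independent terms, one for each unordered pair. -/
theorem sum_mul_adj_sub (W : Graphon) {N : ℕ} (x : Fin N → I) (ω : EdgeSet N)
    (B : Fin N → Fin N → ℝ) :
    ∑ i, ∑ j, B i j * (adj ω - weightedAdj W x) i j
      = ∑ e, (∑ p : Fin N × Fin N with s(p.1, p.2) = e, B p.1 p.2)
          * ((if ω e then 1 else 0) - (edgeProb W x e : ℝ)) := by
  rw [← Fintype.sum_prod_type' (f := fun i j => B i j * (adj ω - weightedAdj W x) i j),
    ← Finset.sum_fiberwise _ (fun p : Fin N × Fin N => s(p.1, p.2))]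
  refine Finset.sum_congr rfl fun e _ => ?_
  rw [Finset.sum_mul]
  refine Finset.sum_congr rfl fun p hp => ?_
  obtain rfl := (Finset.mem_filter.mp hp).2
  simp [adj, weightedAdj, edgeProb]

/-- Each unordered pair comes from at most two ordered pairs, so Cauchy–Schwarz loses at most a
factor `2`. -/
theorem sum_sq_fiber_le {N : ℕ} (B : Fin N → Fin N → ℝ) :
    ∑ e : Sym2 (Fin N), (∑ p : Fin N × Fin N with s(p.1, p.2) = e, B p.1 p.2) ^ 2
      ≤ 2 * ∑ i, ∑ j, B i j ^ 2 := by
  rw [← Fintype.sum_prod_type' (f := fun i j => B i j ^ 2),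
    ← Finset.sum_fiberwise _ (fun p : Fin N × Fin N => s(p.1, p.2)), Finset.mul_sum]
  refine Finset.sum_le_sum fun e _ => ?_
  refine sq_sum_le_card_mul_sum_sq.trans ?_
  refine mul_le_mul_of_nonneg_right ?_ (Finset.sum_nonneg fun _ _ => sq_nonneg _)
  induction e using Sym2.ind with
  | _ i j =>
    have hsub : ({p : Fin N × Fin N | s(p.1, p.2) = s(i, j)} : Finset _) ⊆ {(i, j), (j, i)} := by
      intro p hp
      simpa [Prod.ext_iff] using hp
    exact_mod_cast (Finset.card_le_card hsub).trans Finset.card_le_two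

/-- Two-sided Hoeffding inequality for the linear statistics `∑ᵢⱼ Bᵢⱼ (A - Ā)ᵢⱼ`. -/
theorem measureReal_le_abs_sum_le (W : Graphon) {N : ℕ} (x : Fin N → I)
    (B : Fin N → Fin N → ℝ) {t c : ℝ} (ht : 0 ≤ t) (hc : 0 < c)
    (hB : ∑ i, ∑ j, B i j ^ 2 ≤ c) :
    (edgeLaw W x).real {ω : EdgeSet N | t ≤ |∑ i, ∑ j, B i j * (adj ω - weightedAdj W x) i j|}
      ≤ 2 * Real.exp (-t ^ 2 / c) := by
  have hone (B : Fin N → Fin N → ℝ) (hB : ∑ i, ∑ j, B i j ^ 2 ≤ c) :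
      (edgeLaw W x).real {ω : EdgeSet N | t ≤ ∑ i, ∑ j, B i j * (adj ω - weightedAdj W x) i j}
        ≤ Real.exp (-t ^ 2 / c) := by
    simp_rw [sum_mul_adj_sub]
    exact hoeffding_edge W x _ ht hc ((sum_sq_fiber_le B).trans (by linarith))
  have hsub : {ω : EdgeSet N | t ≤ |∑ i, ∑ j, B i j * (adj ω - weightedAdj W x) i j|}
      ⊆ {ω : EdgeSet N | t ≤ ∑ i, ∑ j, B i j * (adj ω - weightedAdj W x) i j}
        ∪ {ω : EdgeSet N | t ≤ ∑ i, ∑ j, (-B i j) * (adj ω - weightedAdj W x) i j} := by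
    intro ω hω
    simpa [Finset.sum_neg_distrib, neg_mul] using le_abs.mp hω
  calc _ ≤ _ := measureReal_mono hsub
    _ ≤ _ := measureReal_union_le _ _
    _ ≤ Real.exp (-t ^ 2 / c) + Real.exp (-t ^ 2 / c) :=
      add_le_add (hone B hB) (hone _ (by simpa using hB))
    _ = _ := by ring

/-! ### Concentration of degrees and of the adjacency quadratic form -/

theorem deg_adj_sub_deg_weightedAdj (W : Graphon) {N : ℕ} (x : Fin N → I) (ω : EdgeSet N)
    (i : Fin N) : deg (adj ω) i - deg (weightedAdj W x) i
      = ∑ k, ∑ j, (if k = i then 1 else 0) * (adj ω - weightedAdj W x) k j := by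
  simp [deg]

/-- Union bound over the rows of the adjacency matrix. -/
theorem measureReal_exists_lt_abs_deg_sub_le (W : Graphon) {N : ℕ} (x : Fin N → I) {t : ℝ}
    (ht : 0 ≤ t) :
    (edgeLaw W x).real {ω | ∃ i, t < |deg (adj ω) i - deg (weightedAdj W x) i|}
      ≤ N * (2 * Real.exp (-t ^ 2 / N)) := by
  have hrow (i : Fin N) :
      (edgeLaw W x).real {ω | t < |deg (adj ω) i - deg (weightedAdj W x) i|}
        ≤ 2 * Real.exp (-t ^ 2 / N) := by
    refine le_trans (measureReal_mono fun ω hω => ?_) <|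
      measureReal_le_abs_sum_le W x (fun k _ => if k = i then 1 else 0) ht
        (Nat.cast_pos.mpr i.pos) (by simp)
    rw [Set.mem_ofPred_eq, ← deg_adj_sub_deg_weightedAdj]
    exact le_of_lt hω
  rw [Set.ofPred_exists]
  refine (measureReal_iUnion_fintype_le _).trans ?_
  refine (Finset.sum_le_sum fun i _ => hrow i).trans_eq ?_
  simp

/-- Union bound over a `1/2`-net of the unit sphere. -/
theorem measureReal_exists_lt_abs_quadForm_le (W : Graphon) {N : ℕ} (x : Fin N → I) {t : ℝ}
    (ht : 0 ≤ t) :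
    (edgeLaw W x).real
        {ω | ∃ u, 32 / 17 * t * ‖u‖ ^ 2 < |quadForm (adj ω - weightedAdj W x) u|}
      ≤ 5 ^ N * (2 * Real.exp (-t ^ 2)) := by
  obtain ⟨S, hcard, hS1, hS⟩ := exists_half_net_sphere N
  have hpt (c : EuclideanSpace ℝ (Fin N)) (hc : ‖c‖ = 1) :
      (edgeLaw W x).real {ω | t ≤ |quadForm (adj ω - weightedAdj W x) c|}
        ≤ 2 * Real.exp (-t ^ 2) := by
    have hsq : ∑ i, ∑ j, (c i * c j) ^ 2 ≤ 1 := by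
      have h1 : ∑ i, c i ^ 2 = 1 := by
        rw [← EuclideanSpace.real_norm_sq_eq, hc, one_pow]
      simp_rw [mul_pow, ← Finset.mul_sum, h1, mul_one, h1, le_refl]
    have := measureReal_le_abs_sum_le W x (fun i j => c i * c j) ht one_pos hsq
    simpa only [quadForm_eq_sum, div_one] using this
  have hsub : {ω | ∃ u, 32 / 17 * t * ‖u‖ ^ 2 < |quadForm (adj ω - weightedAdj W x) u|}
      ⊆ ⋃ c ∈ S, {ω | t ≤ |quadForm (adj ω - weightedAdj W x) c|} := by
    rintro ω ⟨u, hu⟩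
    by_contra hω
    simp only [Set.mem_iUnion, Set.mem_ofPred_eq, not_exists, not_le] at hω
    have hM : (adj ω - weightedAdj W x).IsHermitian := by
      rw [Matrix.IsHermitian, Matrix.conjTranspose_eq_transpose_of_trivial,
        Matrix.transpose_sub, (adj_isSymm ω).eq, (weightedAdj_isSymm W x).eq]
    exact hu.not_ge (abs_quadForm_le_of_net hM hS1 hS (fun c hc => (hω c hc).le) u)
  calc _ ≤ _ := measureReal_mono hsub (measure_ne_top _ _)
    _ ≤ _ := measureReal_biUnion_finset_le _ _
    _ ≤ ∑ c ∈ S, 2 * Real.exp (-t ^ 2) := Finset.sum_le_sum fun c hc => hpt c (hS1 c hc)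
    _ = S.card * (2 * Real.exp (-t ^ 2)) := by simp
    _ ≤ _ := by gcongr; exact_mod_cast hcard

/-! ### Deterministic comparison of degrees and Laplacian eigenvalues -/

theorem abs_sortedNormDeg_sub_le {N : ℕ} (hN : 0 < N) {A B : Matrix (Fin N) (Fin N) ℝ} {r : ℝ}
    (h : ∀ i, |deg A i - deg B i| ≤ N * r) (i : Fin N) :
    |sortedNormDeg A i - sortedNormDeg B i| ≤ r := by
  have hN' : (0 : ℝ) < N := Nat.cast_pos.mpr hN
  refine abs_orderStat_sub_le (fun j => ?_) i
  rw [← sub_div, abs_div, abs_of_pos hN', div_le_iff₀' hN']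
  exact h j

/-- Weyl's inequality for Laplacians, whose difference is the diagonal matrix of the degree differences
minus the difference of the adjacency matrices. -/
theorem abs_normLapEig_sub_le {N : ℕ} (hN : 0 < N) {A B : Matrix (Fin N) (Fin N) ℝ}
    (hA : A.IsSymm) (hB : B.IsSymm) {s q : ℝ} (hs : ∀ i, |deg A i - deg B i| ≤ N * s)
    (hq : ∀ u, |quadForm (A - B) u| ≤ N * q * ‖u‖ ^ 2) (i : Fin N) :
    |normLapEig hA i - normLapEig hB i| ≤ s + q := by
  have hN' : (0 : ℝ) < N := Nat.cast_pos.mpr hN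
  rw [normLapEig, normLapEig, ← sub_div, abs_div, abs_of_pos hN', div_le_iff₀' hN']
  refine abs_orderStat_eigenvalues_sub_le _ _ (fun u => ?_) i
  have hlap : laplacian A - laplacian B
      = Matrix.diagonal (fun i => deg A i - deg B i) - (A - B) := by
    rw [← Matrix.diagonal_sub, laplacian, laplacian]
    abel
  have hdiag : |quadForm (Matrix.diagonal fun i => deg A i - deg B i) u| ≤ N * s * ‖u‖ ^ 2 := by
    rw [quadForm_diagonal, EuclideanSpace.real_norm_sq_eq, Finset.mul_sum]
    refine (Finset.abs_sum_le_sum_abs _ _).trans (Finset.sum_le_sum fun j _ => ?_)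
    rw [abs_mul, abs_sq]
    exact mul_le_mul_of_nonneg_right (hs j) (sq_nonneg _)
  rw [hlap, quadForm_sub]
  linarith [abs_sub (quadForm (Matrix.diagonal fun i => deg A i - deg B i) u) (quadForm (A - B) u),
    hq u]

theorem abs_adj_sub_weightedAdj_le_one (W : Graphon) {N : ℕ} (x : Fin N → I) (ω : EdgeSet N)
    (i j : Fin N) : |(adj ω - weightedAdj W x) i j| ≤ 1 := by
  have h0 := (W.val (x i) (x j)).2.1
  have h1 := (W.val (x i) (x j)).2.2
  simp only [adj, weightedAdj, Matrix.sub_apply, Matrix.of_apply]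
  split_ifs <;> rw [abs_le] <;> constructor <;> linarith

theorem abs_quadForm_le_of_abs_le_one {N : ℕ} {M : Matrix (Fin N) (Fin N) ℝ}
    (hM : ∀ i j, |M i j| ≤ 1) (u : EuclideanSpace ℝ (Fin N)) :
    |quadForm M u| ≤ N * ‖u‖ ^ 2 := by
  calc |quadForm M u| ≤ ∑ i, ∑ j, |u i| * |u j| := by
        rw [quadForm_eq_sum]
        refine (Finset.abs_sum_le_sum_abs _ _).trans (Finset.sum_le_sum fun i _ => ?_)
        refine (Finset.abs_sum_le_sum_abs _ _).trans (Finset.sum_le_sum fun j _ => ?_)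
        rw [abs_mul, abs_mul]
        exact mul_le_of_le_one_right (by positivity) (hM i j)
    _ = (∑ i, |u i|) ^ 2 := by rw [sq, Finset.sum_mul_sum]
    _ ≤ N * ‖u‖ ^ 2 := by
        rw [EuclideanSpace.real_norm_sq_eq]
        simpa using sq_sum_le_card_mul_sum_sq (s := Finset.univ) (f := fun i => |u i|)

/-! ### Conditional estimates given the latent variables -/

/-- The union bound over the net is at most `ν` as soon as `log (2N/ν) < 4N/9`. Since
`log (2N/ν) ≥ log (2N)`, this condition forces `N ≥ 4`, hence `log (2N/ν) ≥ 3 log 2`, and the exponent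
`(289/256) N log (2N/ν)` outweighs `N log 5 + log (2N/ν)`. -/
theorem five_pow_mul_exp_le {N : ℕ} {ν : ℝ} (hN : 0 < N) (hν0 : 0 < ν) (hν1 : ν < 1)
    (hl : Real.log (2 * N / ν) < 4 / 9 * N) :
    5 ^ N * (2 * Real.exp (-(289 / 256 * (N * Real.log (2 * N / ν))))) ≤ ν := by
  have hN1 : (1 : ℝ) ≤ N := by exact_mod_cast hN
  have hlog2 := Real.log_two_gt_d9
  have hlog2' := Real.log_two_lt_d9
  set l := Real.log (2 * N / ν) with hldef
  have hexp : Real.exp l = 2 * N / ν := Real.exp_log (by positivity)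
  have hmono {k : ℕ} (hk : 2 ^ k ≤ 2 * N) : k * Real.log 2 ≤ l := by
    rw [← Real.log_pow]
    refine Real.log_le_log (by positivity) ?_
    rw [le_div_iff₀ hν0]
    have : (2 : ℝ) ^ k ≤ 2 * N := by exact_mod_cast hk
    nlinarith
  have hN4 : 4 ≤ N := by
    by_contra! hlt
    interval_cases N
    · have := hmono (k := 1) (by norm_num)
      norm_num at this hl
      linarith
    · have := hmono (k := 2) (by norm_num)
      norm_num at this hl
      linarith
    · have := hmono (k := 2) (by norm_num)
      norm_num at this hl
      linarith
  have hl3 := hmono (k := 3) (by omega)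
  have hlog5 : Real.log 5 ≤ 1.6174 := by
    have h := Real.log_le_log (by norm_num) (by norm_num : (5 : ℝ) ^ 3 ≤ 2 ^ 7)
    rw [Real.log_pow, Real.log_pow] at h
    norm_num at h ⊢
    linarith
  have h5 : (5 : ℝ) ^ N = Real.exp (N * Real.log 5) := by
    rw [mul_comm, Real.exp_mul, Real.exp_log (by norm_num), Real.rpow_natCast]
  have hexpo : N * Real.log 5 + -(289 / 256 * (N * l)) ≤ -l := by
    push_cast at hl3
    have hl' : 2.0794 ≤ l := by norm_num; linarith
    nlinarith
  calc 5 ^ N * (2 * Real.exp (-(289 / 256 * (N * l))))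
      = 2 * Real.exp (N * Real.log 5 + -(289 / 256 * (N * l))) := by
        rw [h5, Real.exp_add]
        ring
    _ ≤ 2 * Real.exp (-l) := by gcongr
    _ = ν / N := by
        rw [Real.exp_neg, hexp]
        field_simp
    _ ≤ ν := div_le_self hν0.le hN1

theorem one_sub_le_measureReal_of_compl_subset {N : ℕ} {μ : Measure (EdgeSet N)}
    [IsProbabilityMeasure μ] {s b : Set (EdgeSet N)} {p : ℝ} (hsub : sᶜ ⊆ b) (hb : μ.real b ≤ p) :
    1 - p ≤ μ.real s := by
  have h := probReal_add_probReal_compl (μ := μ) (measurableSet_edgeSet s)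
  linarith [measureReal_mono (μ := μ) hsub]

theorem log_two_mul_div_pos {N : ℕ} (hN : 0 < N) {ν : ℝ} (hν0 : 0 < ν)
    (hν1 : ν < 1) :
    0 < Real.log (2 * N / ν) := by
  have hN1 : (1 : ℝ) ≤ N := by exact_mod_cast hN
  refine Real.log_pos ?_
  rw [lt_div_iff₀ hν0]
  linarith

theorem sq_sqrt_log_div {N : ℕ} (hN : 0 < N) {ν : ℝ} (hν0 : 0 < ν)
    (hν1 : ν < 1) :
    Real.sqrt (Real.log (2 * N / ν) / N) ^ 2 = Real.log (2 * N / ν) / N :=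
  Real.sq_sqrt (div_nonneg (log_two_mul_div_pos hN hν0 hν1).le (Nat.cast_nonneg N))

/-- At `t = √(N log (2N/ν))`, written `N √(log (2N/ν) / N)`, the union bound over the rows equals `ν`. -/
theorem measureReal_exists_radius_lt_abs_deg_sub_le (W : Graphon) {N : ℕ} (hN : 0 < N) {ν : ℝ}
    (hν0 : 0 < ν) (hν1 : ν < 1) (x : Fin N → I) :
    (edgeLaw W x).real {ω | ∃ i, N * Real.sqrt (Real.log (2 * N / ν) / N)
      < |deg (adj ω) i - deg (weightedAdj W x) i|} ≤ ν := by
  have hN' : (0 : ℝ) < N := Nat.cast_pos.mpr hN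
  refine (measureReal_exists_lt_abs_deg_sub_le W x (by positivity)).trans_eq ?_
  have : -(N * Real.sqrt (Real.log (2 * N / ν) / N)) ^ 2 / N = -Real.log (2 * N / ν) := by
    rw [mul_pow, sq_sqrt_log_div hN hν0 hν1]
    field_simp
  rw [this, Real.exp_neg, Real.exp_log (by positivity)]
  field_simp

theorem one_sub_le_measureReal_degreesClose (W : Graphon) {N : ℕ} (hN : 0 < N) {ν : ℝ}
    (hν0 : 0 < ν) (hν1 : ν < 1) (x : Fin N → I) :
    1 - ν ≤ (edgeLaw W x).real
      {e | DegreesClose W (Real.sqrt (Real.log (2 * N / ν) / N)) x e} := by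
  refine one_sub_le_measureReal_of_compl_subset (fun ω hω => ?_)
    (measureReal_exists_radius_lt_abs_deg_sub_le W hN hν0 hν1 x)
  by_contra hgood
  simp only [Set.mem_ofPred_eq, not_exists, not_lt] at hgood
  exact hω (abs_sortedNormDeg_sub_le hN hgood)

theorem one_sub_le_measureReal_eigenvaluesClose (W : Graphon) {N : ℕ} (hN : 0 < N) {ν : ℝ}
    (hν0 : 0 < ν) (hν1 : ν < 1) (x : Fin N → I) :
    1 - 2 * ν ≤ (edgeLaw W x).real
      {e | EigenvaluesClose W (3 * Real.sqrt (Real.log (2 * N / ν) / N)) x e} := by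
  have hN' : (0 : ℝ) < N := Nat.cast_pos.mpr hN
  set r := Real.sqrt (Real.log (2 * N / ν) / N) with hr
  have hr0 : 0 ≤ r := Real.sqrt_nonneg _
  have hr2 : r ^ 2 = Real.log (2 * N / ν) / N := sq_sqrt_log_div hN hν0 hν1
  -- If `log (2N/ν) ≥ 4N/9`, the radius `3 r` is at least `2` and the bound holds for every graph.
  rcases le_or_gt (4 / 9 * (N : ℝ)) (Real.log (2 * N / ν)) with hl | hl
  · have hr23 : 2 / 3 ≤ r := by
      refine Real.le_sqrt_of_sq_le ?_
      rw [le_div_iff₀ hN']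
      linarith
    have hall : {e | EigenvaluesClose W (3 * r) x e} = Set.univ := by
      refine Set.eq_univ_of_forall fun ω i => ?_
      have hentry := abs_adj_sub_weightedAdj_le_one W x ω
      refine (abs_normLapEig_sub_le hN (adj_isSymm ω) (weightedAdj_isSymm W x) (s := 1) (q := 1)
        (fun k => ?_) (fun u => ?_) i).trans (by linarith)
      · rw [deg, deg, ← Finset.sum_sub_distrib]
        refine (Finset.abs_sum_le_sum_abs _ _).trans ?_
        refine (Finset.sum_le_sum fun j _ => hentry k j).trans_eq ?_
        simp
      · rw [mul_one]
        exact abs_quadForm_le_of_abs_le_one hentry u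
    rw [hall, probReal_univ]
    linarith
  -- The factor `17/16` cancels the loss `32/17` of the net to leave `2 N r`.
  · have hquad : (edgeLaw W x).real {ω | ∃ u, 32 / 17 * (17 / 16 * (N * r)) * ‖u‖ ^ 2
        < |quadForm (adj ω - weightedAdj W x) u|} ≤ ν := by
      refine (measureReal_exists_lt_abs_quadForm_le W x (by positivity)).trans ?_
      have : -(17 / 16 * (N * r)) ^ 2 = -(289 / 256 * (N * Real.log (2 * N / ν))) := by
        rw [mul_pow, mul_pow, hr2]
        field_simp
        ring
      rw [this]
      exact five_pow_mul_exp_le hN hν0 hν1 hl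
    refine one_sub_le_measureReal_of_compl_subset (fun ω hω => ?_)
      ((measureReal_union_le _ _).trans
        ((add_le_add (measureReal_exists_radius_lt_abs_deg_sub_le W hN hν0 hν1 x) hquad).trans_eq
          (two_mul ν).symm))
    by_contra hgood
    simp only [Set.mem_union, Set.mem_ofPred_eq, not_or, not_exists, not_lt] at hgood
    refine hω fun i => ?_
    refine (abs_normLapEig_sub_le hN _ _ (q := 2 * r) hgood.1 (fun u => ?_) i).trans_eq (by ring)
    exact (hgood.2 u).trans_eq (by ring)

/-! ### The joint law -/

/-- Integrates a conditional lower bound over a set of latent variables. No measurability of `P` in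
`x` is needed, since the composition product of a set is always at least the integral of the measures
of its sections. -/
theorem ofReal_mul_latentLaw_le_sampleLaw (W : Graphon) {N : ℕ} {E : Set (Fin N → I)}
    (hE : MeasurableSet E) {P : (Fin N → I) → EdgeSet N → Prop} {p : ℝ}
    (hP : ∀ x ∈ E, p ≤ (edgeLaw W x).real {e | P x e}) :
    ENNReal.ofReal p * latentLaw N E ≤ sampleLaw W N {q | q.1 ∈ E ∧ P q.1 q.2} := by
  calc ENNReal.ofReal p * latentLaw N E = ∫⁻ _ in E, ENNReal.ofReal p ∂(latentLaw N) := by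
        rw [setLIntegral_const]
    _ ≤ ∫⁻ x in E, edgeKernel W N x {e | x ∈ E ∧ P x e} ∂(latentLaw N) := by
        refine setLIntegral_mono' hE fun x hx => ?_
        simp only [hx, true_and]
        exact ENNReal.ofReal_le_of_le_toReal (hP x hx)
    _ ≤ ∫⁻ x, edgeKernel W N x {e | x ∈ E ∧ P x e} ∂(latentLaw N) := setLIntegral_le_lintegral _ _
    _ ≤ _ := by
        have := Kernel.le_compProd_apply (Kernel.const Unit (latentLaw N))
          (Kernel.prodMkLeft Unit (edgeKernel W N)) () {q | q.1 ∈ E ∧ P q.1 q.2}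
        simpa [sampleLaw, Measure.compProd] using this

/-- The largest degree exceeds `c` exactly when some degree does. -/
theorem measurableSet_lt_maxWeightedDeg (W : Graphon) {N : ℕ} (hN : 0 < N) (c : ℝ) :
    MeasurableSet {x : Fin N → I | c < maxWeightedDeg W hN x} := by
  have h : {x : Fin N → I | c < maxWeightedDeg W hN x}
      = ⋃ i, {x | c < deg (weightedAdj W x) i} := by
    ext x
    simp only [Set.mem_ofPred_eq, Set.mem_iUnion, maxWeightedDeg]
    refine ⟨fun hx => ⟨_, hx⟩, fun ⟨i, hi⟩ => hi.trans_le ?_⟩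
    have hmono : Monotone (orderStat (deg (weightedAdj W x))) := Tuple.monotone_sort _
    have hle := hmono (show (Tuple.sort (deg (weightedAdj W x))).symm i ≤ ⟨N - 1, by omega⟩ from
      Fin.le_def.mpr (Nat.le_sub_one_of_lt (Fin.is_lt _)))
    simpa [orderStat] using hle
  rw [h]
  refine MeasurableSet.iUnion fun i => measurableSet_lt measurable_const ?_
  refine Finset.measurable_sum _ fun j _ => ?_
  exact measurable_subtype_coe.comp (measurable_edgeProb W N s(i, j))

end GraphonSampling

end

open GraphonSampling in
theorem lemmaI (W : Graphon) (N : ℕ) (hN : 0 < N) (ν : ℝ) (hν0 : 0 < ν) (hν1 : ν < 1) :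
    -- conditionally on any value `x` of the latent variables
    (∀ x : Fin N → unitInterval,
      1 - ν ≤ (edgeLaw W x).real
        {e | DegreesClose W (Real.sqrt (Real.log (2 * N / ν) / N)) x e} ∧
      (4 / 9 * Real.log (2 * N / ν) < maxWeightedDeg W hN x →
        1 - 2 * ν ≤ (edgeLaw W x).real
          {e | EigenvaluesClose W (3 * Real.sqrt (Real.log (2 * N / ν) / N)) x e})) ∧
    -- under the joint law of the latent variables and the sampled graph
    1 - ν ≤ (sampleLaw W N).real
      {p | DegreesClose W (Real.sqrt (Real.log (2 * N / ν) / N)) p.1 p.2} ∧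
    (sampleLaw W N {p | 4 / 9 * Real.log (2 * N / ν) < maxWeightedDeg W hN p.1} ≠ 0 →
      1 - 2 * ν ≤
        (ProbabilityTheory.cond (sampleLaw W N)
          {p | 4 / 9 * Real.log (2 * N / ν) < maxWeightedDeg W hN p.1}).real
          {p | EigenvaluesClose W (3 * Real.sqrt (Real.log (2 * N / ν) / N)) p.1 p.2}) := by
  have hdeg := one_sub_le_measureReal_degreesClose W hN hν0 hν1
  have heig := one_sub_le_measureReal_eigenvaluesClose W hN hν0 hν1
  have : MeasureTheory.IsProbabilityMeasure (sampleLaw W N) := by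
    unfold sampleLaw; infer_instance
  refine ⟨fun x => ⟨hdeg x, fun _ => heig x⟩, ?_, fun hpos => ?_⟩
  · have h := ofReal_mul_latentLaw_le_sampleLaw W MeasurableSet.univ (fun x _ => hdeg x)
    rw [MeasureTheory.measure_univ, mul_one] at h
    simp only [Set.mem_univ, true_and] at h
    exact (ENNReal.ofReal_le_iff_le_toReal (MeasureTheory.measure_ne_top _ _)).mp h
  · have hE := measurableSet_lt_maxWeightedDeg W hN (4 / 9 * Real.log (2 * N / ν))
    have hfst : sampleLaw W N {p | 4 / 9 * Real.log (2 * N / ν) < maxWeightedDeg W hN p.1}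
        = latentLaw N {x | 4 / 9 * Real.log (2 * N / ν) < maxWeightedDeg W hN x} := by
      rw [← MeasureTheory.Measure.fst_compProd (latentLaw N) (edgeKernel W N),
        MeasureTheory.Measure.fst_apply hE]
      rfl
    have h := ofReal_mul_latentLaw_le_sampleLaw W hE (fun x _ => heig x)
    rw [← hfst] at h
    have hEfst : MeasurableSet {p : (Fin N → unitInterval) × EdgeSet N |
        4 / 9 * Real.log (2 * N / ν) < maxWeightedDeg W hN p.1} := measurable_fst hE
    rw [MeasureTheory.measureReal_def, ProbabilityTheory.cond_apply hEfst]
    refine (ENNReal.ofReal_le_iff_le_toReal ?_).mp ?_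
    · exact ENNReal.mul_ne_top (ENNReal.inv_ne_top.mpr hpos) (MeasureTheory.measure_ne_top _ _)
    · rw [mul_comm (_⁻¹ : ENNReal), ← div_eq_mul_inv,
        ENNReal.le_div_iff_mul_le (Or.inl hpos) (Or.inl (MeasureTheory.measure_ne_top _ _))]
      exact h
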